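/- \textbf{Corollary} (Squier). Let $\Sigma=(\Sigma_0,\Sigma_1,\Sigma_2)$ be a convergent $2$-polygraph. Any Squier completion $\mathcal{S}(\Sigma)$ of $\Sigma$ is a coherent presentation of the category presented by $\Sigma$. Here a \emph{$2$-polygraph} $\Sigma$ consists of a directed graph $(\Sigma_0,\Sigma_1)$, generating a free category $\Sigma_1^\ast$ whose morphisms are called $1$-cells, and of a set $\Sigma_2$ of generating $2$-cells $\varphi : p \Rightarrow q$ between parallel $1$-cells. The \emph{category presented by} $\Sigma$ is the quotient of $\Sigma_1^\ast$ by the congruence generated by $\Sigma_2$. We write $\Sigma_2^\top$ for the free $(2,1)$-category generated by $\Sigma$, with $0$-composition written as juxtaposition and $1$-composition written $\star_1$. A \emph{rewriting step} is a $2$-cell $u\varphi v : upv \Rightarrow uqv$, where $\varphi : p\Rightarrow q$ is in $\Sigma_2$ and $u,v$ are $1$-cells; a \emph{rewriting sequence} is a sequence of composable rewriting steps, and a finite one (possibly of length zero) is identified with the $\star_1$-composite of its steps. $\Sigma$ is \emph{convergent} if it is terminating (there is no infinite rewriting sequence) and confluent (for any two finite rewriting sequences $p\Rightarrow q$ and $p\Rightarrow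 r$ with the same source there are finite rewriting sequences $q\Rightarrow s$ and $r\Rightarrow s$ with the same target). A \emph{local branching} is a pair $(f,g)$ of rewriting steps with the same source; it is \emph{aspherical} if $f=g$, and \emph{Peiffer} if, up to exchange of its two members, it is of the form $(f'v,ug')$ for rewriting steps $f'$ of source $u$ and $g'$ of source $v$. A \emph{critical branching} is a local branching that is neither aspherical nor Peiffer and that is minimal for the order on local branchings given by $(f,g)\sqsubseteq (wfw',wgw')$ for $1$-cells $w,w'$. Branchings are considered up to exchange of their two members. A \emph{Squier completion} of $\Sigma$ is $\Sigma$ together with a \emph{family of generating confluences}, that is, a set $\Sigma_3$ of $3$-cells made of exactly one $3$-cell of the form $f\star_1 f' \Rrightarrow g\star_1 g'$ for each critical branching $(f,g)$ of $\Sigma$, where $f'$ and $g'$ are finite rewriting sequences with the same target, starting at the targets of $f$ and of $g$ respectively. The pair $(\Sigma,\Sigma_3)$ is a \emph{coherent presentation} of a category $\mathbf{C}$ if the category presented by $\Sigma$ is isomorphic to $\mathbf{C}$ and $\Sigma_3$ is a homotopy basis of $\Sigma_2^\top$: for any two parallel $2$-cells $f,g$ of $\Sigma_2^\top$ there is a $3$-cell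 from $f$ to $g$ in the free $(3,1)$-category generated by $(\Sigma,\Sigma_3)$. -/

import Mathlib

open CategoryTheory Bicategory

universe u v w t

/-- A `2`-polygraph: `0`-cells, generating `1`-cells, and a globular extension of the free category
on them. The generating `2`-cells with `1`-source `p` and `1`-target `q` (two parallel paths of
generating `1`-cells) form the type `Rule p q`. -/
structure TwoPolygraph where
  /-- the `0`-cells -/
  Obj : Type u
  /-- the generating `1`-cells -/
  [quiver : Quiver.{v} Obj]
  /-- the generating `2`-cells -/
  Rule : ∀ {x y : Obj}, Quiver.Path x y → Quiver.Path x y → Type w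

attribute [instance] TwoPolygraph.quiver

namespace TwoPolygraph

/-- The relation on the free category that is given by the `2`-cells. -/
def homRel (P : TwoPolygraph.{u, v, w}) : HomRel (Paths P.Obj) :=
  fun x y p q => Nonempty (P.Rule (x := x) (y := y) p q)

/-- The category presented by `P`: the quotient of the free category by the congruence generated by
the `2`-cells. -/
abbrev PresentedCategory (P : TwoPolygraph.{u, v, w}) : Type u :=
  CategoryTheory.Quotient P.homRel

/-- `P` is a presentation of `C`: the category presented by `P` is isomorphic to `C`. -/
def Presents (P : TwoPolygraph.{u, v, w}) (C : Type*) [Category* C] : Prop :=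
  ∃ (F : P.PresentedCategory ⥤ C) (G : C ⥤ P.PresentedCategory), F ⋙ G = 𝟭 _ ∧ G ⋙ F = 𝟭 _

/-! ### The free `(2,1)`-category -/

/-- The `0`-cells of the free `(2,1)`-category generated by `P`. -/
def Free (P : TwoPolygraph.{u, v, w}) : Type u := P.Obj

variable {P : TwoPolygraph.{u, v, w}}

/-- The `1`-cells are the paths of generating `1`-cells. -/
instance : CategoryStruct P.Free where
  Hom x y := @Quiver.Path P.Obj _ x y
  id _ := Quiver.Path.nil
  comp p q := Quiver.Path.comp p q

theorem Free.idComp {x y : P.Free} (p : x ⟶ y) : 𝟙 x ≫ p = p := Quiver.Path.nil_comp p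
theorem Free.compId {x y : P.Free} (p : x ⟶ y) : p ≫ 𝟙 y = p := Quiver.Path.comp_nil p
theorem Free.assoc {x y z t : P.Free} (p : x ⟶ y) (q : y ⟶ z) (r : z ⟶ t) :
    (p ≫ q) ≫ r = p ≫ (q ≫ r) := Quiver.Path.comp_assoc p q r

/-- Formal composites of generating `2`-cells and their inverses. -/
inductive FormalCell (P : TwoPolygraph.{u, v, w}) :
    ∀ {x y : P.Free}, (x ⟶ y) → (x ⟶ y) → Type (max u v w)
  /-- a generating `2`-cell -/
  | of {x y : P.Free} {p q : x ⟶ y} (φ : P.Rule p q) : FormalCell P p q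
  /-- the identity of a `1`-cell, between two equal expressions of that `1`-cell -/
  | ofEq {x y : P.Free} {p q : x ⟶ y} (h : p = q) : FormalCell P p q
  /-- `1`-composition -/
  | comp {x y : P.Free} {p q r : x ⟶ y} (f : FormalCell P p q) (g : FormalCell P q r) :
      FormalCell P p r
  /-- inverse for the `1`-composition -/
  | inv {x y : P.Free} {p q : x ⟶ y} (f : FormalCell P p q) : FormalCell P q p
  /-- `0`-composition with a `1`-cell on the left -/
  | whiskerL {x y z : P.Free} (a : x ⟶ y) {p q : y ⟶ z} (f : FormalCell P p q) :
      FormalCell P (a ≫ p) (a ≫ q)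
  /-- `0`-composition with a `1`-cell on the right -/
  | whiskerR {x y z : P.Free} {p q : x ⟶ y} (f : FormalCell P p q) (a : y ⟶ z) :
      FormalCell P (p ≫ a) (q ≫ a)

namespace FormalCell

/-- The congruence on formal composites generated by the axioms of strict `2`-categories and by the
invertibility of `2`-cells. -/
inductive Rel : ∀ {x y : P.Free} {p q : x ⟶ y}, FormalCell P p q → FormalCell P p q → Prop
  -- equivalence relation
  | refl {x y : P.Free} {p q : x ⟶ y} (f : FormalCell P p q) : Rel f f
  | symm {x y : P.Free} {p q : x ⟶ y} {f g : FormalCell P p q} : Rel f g → Rel g f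
  | trans {x y : P.Free} {p q : x ⟶ y} {f g h : FormalCell P p q} : Rel f g → Rel g h → Rel f h
  -- compatibility with the operations
  | comp_congr {x y : P.Free} {p q r : x ⟶ y} {f f' : FormalCell P p q} {g g' : FormalCell P q r} :
      Rel f f' → Rel g g' → Rel (f.comp g) (f'.comp g')
  | inv_congr {x y : P.Free} {p q : x ⟶ y} {f f' : FormalCell P p q} : Rel f f' → Rel f.inv f'.inv
  | whiskerL_congr {x y z : P.Free} (a : x ⟶ y) {p q : y ⟶ z} {f f' : FormalCell P p q} :
      Rel f f' → Rel (whiskerL a f) (whiskerL a f')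
  | whiskerR_congr {x y z : P.Free} {p q : x ⟶ y} {f f' : FormalCell P p q} (a : y ⟶ z) :
      Rel f f' → Rel (whiskerR f a) (whiskerR f' a)
  -- the `1`-cells and `2`-cells between two `0`-cells form a groupoid
  | id_comp {x y : P.Free} {p q : x ⟶ y} (f : FormalCell P p q) : Rel ((ofEq rfl).comp f) f
  | comp_id {x y : P.Free} {p q : x ⟶ y} (f : FormalCell P p q) : Rel (f.comp (ofEq rfl)) f
  | assoc {x y : P.Free} {p q r s : x ⟶ y} (f : FormalCell P p q) (g : FormalCell P q r)
      (h : FormalCell P r s) : Rel ((f.comp g).comp h) (f.comp (g.comp h))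
  | comp_inv {x y : P.Free} {p q : x ⟶ y} (f : FormalCell P p q) : Rel (f.comp f.inv) (ofEq rfl)
  | inv_comp {x y : P.Free} {p q : x ⟶ y} (f : FormalCell P p q) : Rel (f.inv.comp f) (ofEq rfl)
  -- `0`-composition with a `1`-cell is functorial
  | whiskerL_id {x y z : P.Free} (a : x ⟶ y) (p : y ⟶ z) :
      Rel (whiskerL a (ofEq (rfl : p = p))) (ofEq rfl)
  | whiskerL_comp {x y z : P.Free} (a : x ⟶ y) {p q r : y ⟶ z} (f : FormalCell P p q)
      (g : FormalCell P q r) : Rel (whiskerL a (f.comp g)) ((whiskerL a f).comp (whiskerL a g))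
  | whiskerR_id {x y z : P.Free} (p : x ⟶ y) (a : y ⟶ z) :
      Rel (whiskerR (ofEq (rfl : p = p)) a) (ofEq rfl)
  | whiskerR_comp {x y z : P.Free} {p q r : x ⟶ y} (f : FormalCell P p q) (g : FormalCell P q r)
      (a : y ⟶ z) : Rel (whiskerR (f.comp g) a) ((whiskerR f a).comp (whiskerR g a))
  -- `0`-composition is unital and associative
  | whiskerL_one {x y : P.Free} {p q : x ⟶ y} (f : FormalCell P p q) :
      Rel (whiskerL (𝟙 x) f)
        ((ofEq (Free.idComp p)).comp (f.comp (ofEq (Free.idComp q).symm)))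
  | whiskerR_one {x y : P.Free} {p q : x ⟶ y} (f : FormalCell P p q) :
      Rel (whiskerR f (𝟙 y))
        ((ofEq (Free.compId p)).comp (f.comp (ofEq (Free.compId q).symm)))
  | whiskerL_mul {x y z t : P.Free} (a : x ⟶ y) (b : y ⟶ z) {p q : z ⟶ t}
      (f : FormalCell P p q) :
      Rel (whiskerL (a ≫ b) f)
        ((ofEq (Free.assoc a b p)).comp
          ((whiskerL a (whiskerL b f)).comp (ofEq (Free.assoc a b q).symm)))
  | whiskerR_mul {x y z t : P.Free} {p q : x ⟶ y} (f : FormalCell P p q) (a : y ⟶ z)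
      (b : z ⟶ t) :
      Rel (whiskerR f (a ≫ b))
        ((ofEq (Free.assoc p a b).symm).comp
          ((whiskerR (whiskerR f a) b).comp (ofEq (Free.assoc q a b))))
  | whisker_assoc {x y z t : P.Free} (a : x ⟶ y) {p q : y ⟶ z} (f : FormalCell P p q)
      (b : z ⟶ t) :
      Rel (whiskerR (whiskerL a f) b)
        ((ofEq (Free.assoc a p b)).comp
          ((whiskerL a (whiskerR f b)).comp (ofEq (Free.assoc a q b).symm)))
  -- exchange law
  | exchange {x y z : P.Free} {p q : x ⟶ y} {r s : y ⟶ z} (f : FormalCell P p q)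
      (g : FormalCell P r s) :
      Rel ((whiskerL p g).comp (whiskerR f s)) ((whiskerR f r).comp (whiskerL q g))

/-- Equality of formal composites in the free `(2,1)`-category. -/
def setoid {x y : P.Free} (p q : x ⟶ y) : Setoid (FormalCell P p q) :=
  ⟨Rel, Rel.refl, Rel.symm, Rel.trans⟩

end FormalCell

/-- The `2`-cells of the free `(2,1)`-category generated by `P`. -/
def TwoCell {x y : P.Free} (p q : x ⟶ y) : Type (max u v w) := _root_.Quotient (FormalCell.setoid p q)

namespace TwoCell

/-- The class of a formal composite. -/
def mk {x y : P.Free} {p q : x ⟶ y} (f : FormalCell P p q) : TwoCell p q :=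
  Quotient.mk (FormalCell.setoid p q) f

theorem sound {x y : P.Free} {p q : x ⟶ y} {f g : FormalCell P p q} (h : FormalCell.Rel f g) :
    mk f = mk g := Quotient.sound (s := FormalCell.setoid p q) h

theorem ind {x y : P.Free} {p q : x ⟶ y} {motive : TwoCell p q → Prop}
    (h : ∀ f : FormalCell P p q, motive (mk f)) (f : TwoCell p q) : motive f :=
  Quotient.ind (s := FormalCell.setoid p q) h f

/-- The `1`-composition. -/
def comp {x y : P.Free} {p q r : x ⟶ y} : TwoCell p q → TwoCell q r → TwoCell p r :=
  Quotient.map₂ FormalCell.comp (fun _ _ h _ _ h' => FormalCell.Rel.comp_congr h h')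

/-- The inverse for the `1`-composition. -/
def inv {x y : P.Free} {p q : x ⟶ y} : TwoCell p q → TwoCell q p :=
  Quotient.map FormalCell.inv (fun _ _ h => FormalCell.Rel.inv_congr h)

/-- `0`-composition with a `1`-cell on the left. -/
def whiskerL {x y z : P.Free} (a : x ⟶ y) {p q : y ⟶ z} :
    TwoCell p q → TwoCell (a ≫ p) (a ≫ q) :=
  Quotient.map (FormalCell.whiskerL a) (fun _ _ h => FormalCell.Rel.whiskerL_congr a h)

/-- `0`-composition with a `1`-cell on the right. -/
def whiskerR {x y z : P.Free} {p q : x ⟶ y} (f : TwoCell p q) (a : y ⟶ z) :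
    TwoCell (p ≫ a) (q ≫ a) :=
  Quotient.map (fun f => FormalCell.whiskerR f a)
    (fun _ _ h => FormalCell.Rel.whiskerR_congr a h) f

end TwoCell

instance homGroupoid (x y : P.Free) : Groupoid (x ⟶ y) where
  Hom p q := TwoCell p q
  id p := TwoCell.mk (FormalCell.ofEq rfl)
  comp f g := TwoCell.comp f g
  inv f := TwoCell.inv f
  id_comp f := by
    induction f using TwoCell.ind with | h f => exact TwoCell.sound (.id_comp f)
  comp_id f := by
    induction f using TwoCell.ind with | h f => exact TwoCell.sound (.comp_id f)
  assoc f g h := by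
    induction f using TwoCell.ind with | h f =>
    induction g using TwoCell.ind with | h g =>
    induction h using TwoCell.ind with | h h => exact TwoCell.sound (.assoc f g h)
  inv_comp f := by
    induction f using TwoCell.ind with | h f => exact TwoCell.sound (.inv_comp f)
  comp_inv f := by
    induction f using TwoCell.ind with | h f => exact TwoCell.sound (.comp_inv f)

theorem mk_ofEq {x y : P.Free} {p q : x ⟶ y} (h : p = q) :
    (TwoCell.mk (FormalCell.ofEq h) : p ⟶ q) = eqToHom h := by
  subst h; rfl

theorem whiskerL_eqToHom {x y z : P.Free} (a : x ⟶ y) {p q : y ⟶ z} (h : p = q) :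
    (TwoCell.whiskerL a (eqToHom h : p ⟶ q) : a ≫ p ⟶ a ≫ q) =
      eqToHom (congrArg (fun r => a ≫ r) h) := by
  subst h; exact TwoCell.sound (.whiskerL_id a p)

theorem whiskerR_eqToHom {x y z : P.Free} {p q : x ⟶ y} (h : p = q) (a : y ⟶ z) :
    (TwoCell.whiskerR (eqToHom h : p ⟶ q) a : p ≫ a ⟶ q ≫ a) =
      eqToHom (congrArg (fun r => r ≫ a) h) := by
  subst h; exact TwoCell.sound (.whiskerR_id p a)

/-- The free `(2,1)`-category generated by `P`. -/
instance : Bicategory P.Free where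
  homCategory x y := (homGroupoid x y).toCategory
  whiskerLeft a _ _ f := TwoCell.whiskerL a f
  whiskerRight f a := TwoCell.whiskerR f a
  associator p q r := eqToIso (Free.assoc p q r)
  leftUnitor p := eqToIso (Free.idComp p)
  rightUnitor p := eqToIso (Free.compId p)
  whiskerLeft_id a p := TwoCell.sound (.whiskerL_id a p)
  whiskerLeft_comp a _ _ _ f g := by
    induction f using TwoCell.ind with | h f =>
    induction g using TwoCell.ind with | h g => exact TwoCell.sound (.whiskerL_comp a f g)
  id_whiskerLeft {_ _ p q} f := by
    induction f using TwoCell.ind with | h f =>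
    refine (TwoCell.sound (.whiskerL_one f)).trans ?_
    rw [eqToIso.hom, eqToIso.inv, ← mk_ofEq, ← mk_ofEq]; rfl
  comp_whiskerLeft a b _ _ f := by
    induction f using TwoCell.ind with | h f =>
    refine (TwoCell.sound (.whiskerL_mul a b f)).trans ?_
    rw [eqToIso.hom, eqToIso.inv, ← mk_ofEq, ← mk_ofEq]; rfl
  id_whiskerRight p a := TwoCell.sound (.whiskerR_id p a)
  comp_whiskerRight f g a := by
    induction f using TwoCell.ind with | h f =>
    induction g using TwoCell.ind with | h g => exact TwoCell.sound (.whiskerR_comp f g a)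
  whiskerRight_id f := by
    induction f using TwoCell.ind with | h f =>
    refine (TwoCell.sound (.whiskerR_one f)).trans ?_
    rw [eqToIso.hom, eqToIso.inv, ← mk_ofEq, ← mk_ofEq]; rfl
  whiskerRight_comp f a b := by
    induction f using TwoCell.ind with | h f =>
    refine (TwoCell.sound (.whiskerR_mul f a b)).trans ?_
    rw [eqToIso.hom, eqToIso.inv, ← mk_ofEq, ← mk_ofEq]; rfl
  whisker_assoc a _ _ f b := by
    induction f using TwoCell.ind with | h f =>
    refine (TwoCell.sound (.whisker_assoc a f b)).trans ?_
    rw [eqToIso.hom, eqToIso.inv, ← mk_ofEq, ← mk_ofEq]; rfl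
  whisker_exchange f g := by
    induction f using TwoCell.ind with | h f =>
    induction g using TwoCell.ind with | h g => exact TwoCell.sound (.exchange f g)
  pentagon p q r s := by
    simp only [eqToIso.hom, whiskerL_eqToHom, whiskerR_eqToHom, eqToHom_trans]
  triangle p q := by
    simp only [eqToIso.hom, whiskerL_eqToHom, whiskerR_eqToHom, eqToHom_trans]

instance : Bicategory.Strict P.Free where
  id_comp := Free.idComp
  comp_id := Free.compId
  assoc := Free.assoc
  leftUnitor_eqToIso _ := rfl
  rightUnitor_eqToIso _ := rfl
  associator_eqToIso _ _ _ := rfl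

/-- All `2`-cells are invertible. -/
theorem Free.isLocallyGroupoid : Bicategory.IsLocallyGroupoid P.Free :=
  fun x y => ⟨fun f => ⟨(homGroupoid x y).inv f,
    (homGroupoid x y).comp_inv f, (homGroupoid x y).inv_comp f⟩⟩

/-- A generating `2`-cell, as a `2`-cell of the free `(2,1)`-category. -/
def ofRule {x y : P.Free} {p q : x ⟶ y} (φ : P.Rule p q) : p ⟶ q :=
  TwoCell.mk (FormalCell.of φ)

/-! ### Rewriting -/

/-- A rewriting step `left φ right` between `1`-cells from `x` to `y`, where `φ` is a generating
`2`-cell. -/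
structure Step (P : TwoPolygraph.{u, v, w}) (x y : P.Free) where
  {a : P.Free}
  {b : P.Free}
  left : x ⟶ a
  {p : a ⟶ b}
  {q : a ⟶ b}
  rule : P.Rule p q
  right : b ⟶ y

namespace Step

variable {x y : P.Free}

/-- The `1`-source of a rewriting step. -/
def src (f : P.Step x y) : x ⟶ y := f.left ≫ f.p ≫ f.right

/-- The `1`-target of a rewriting step. -/
def tgt (f : P.Step x y) : x ⟶ y := f.left ≫ f.q ≫ f.right

/-- The `2`-cell of the free `(2,1)`-category defined by a rewriting step. -/
def toCell (f : P.Step x y) : f.src ⟶ f.tgt := f.left ◁ ofRule f.rule ▷ f.right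

/-- The rewriting step `c f d`. -/
def whisker {x' y' : P.Free} (c : x' ⟶ x) (f : P.Step x y) (d : y ⟶ y') : P.Step x' y' where
  left := c ≫ f.left
  rule := f.rule
  right := f.right ≫ d

theorem whisker_src {x' y' : P.Free} (c : x' ⟶ x) (f : P.Step x y) (d : y ⟶ y') :
    (f.whisker c d).src = c ≫ f.src ≫ d := by
  simp only [src, whisker, Free.assoc]

end Step

/-- Finite rewriting sequences (possibly of length zero) from a `1`-cell to another one. -/
inductive RewritingSequence {x y : P.Free} : (x ⟶ y) → (x ⟶ y) → Type (max u v w)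
  | nil (p : x ⟶ y) : RewritingSequence p p
  | cons {p q : x ⟶ y} (f : P.Step x y) (h : f.src = p) (s : RewritingSequence f.tgt q) :
      RewritingSequence p q

/-- The `2`-cell `f₀ ⋆₁ f₁ ⋆₁ ⋯ ⋆₁ fₙ` defined by a finite rewriting sequence. -/
def RewritingSequence.toCell {x y : P.Free} {p q : x ⟶ y} : RewritingSequence p q → (p ⟶ q)
  | .nil p => 𝟙 p
  | .cons f h s => eqToHom h.symm ≫ f.toCell ≫ s.toCell

/-- There is no infinite rewriting sequence. -/
def Terminating (P : TwoPolygraph.{u, v, w}) : Prop :=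
  ∀ x y : P.Free, ¬ ∃ p : ℕ → (x ⟶ y), ∀ n, ∃ f : P.Step x y, f.src = p n ∧ f.tgt = p (n + 1)

/-- Every branching of finite rewriting sequences can be completed by a confluence. -/
def Confluent (P : TwoPolygraph.{u, v, w}) : Prop :=
  ∀ {x y : P.Free} {p q r : x ⟶ y}, RewritingSequence p q → RewritingSequence p r →
    ∃ s : x ⟶ y, Nonempty (RewritingSequence q s) ∧ Nonempty (RewritingSequence r s)

/-- A convergent `2`-polygraph. -/
def Convergent (P : TwoPolygraph.{u, v, w}) : Prop := P.Confluent ∧ P.Terminating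

/-- A local branching: a pair of rewriting steps with a common source. -/
structure LocalBranching (P : TwoPolygraph.{u, v, w}) where
  {x : P.Free}
  {y : P.Free}
  fst : P.Step x y
  snd : P.Step x y
  src_eq : fst.src = snd.src

namespace LocalBranching

/-- The local branching `(g, f)`. -/
def swap (B : P.LocalBranching) : P.LocalBranching := ⟨B.snd, B.fst, B.src_eq.symm⟩

/-- The local branching `(c f d, c g d)`. -/
def whisker {x' y' : P.Free} (B : P.LocalBranching) (c : x' ⟶ B.x) (d : B.y ⟶ y') :
    P.LocalBranching :=
  ⟨B.fst.whisker c d, B.snd.whisker c d, by rw [Step.whisker_src, Step.whisker_src, B.src_eq]⟩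

/-- `(f, f)`. -/
def IsAspherical (B : P.LocalBranching) : Prop := B.fst = B.snd

/-- `(f v, u g)` or `(u g, f v)`, for rewriting steps `f` of source `u` and `g` of source `v`. -/
def IsPeiffer (B : P.LocalBranching) : Prop :=
  ∃ (z : P.Free) (f : P.Step B.x z) (g : P.Step z B.y),
    (B.fst = f.whisker (𝟙 _) g.src ∧ B.snd = g.whisker f.src (𝟙 _)) ∨
    (B.snd = f.whisker (𝟙 _) g.src ∧ B.fst = g.whisker f.src (𝟙 _))

/-- A local branching that is neither aspherical nor Peiffer. -/
def IsOverlapping (B : P.LocalBranching) : Prop := ¬ B.IsAspherical ∧ ¬ B.IsPeiffer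

/-- The order on local branchings: `(f, g) ⊑ (c f d, c g d)`. -/
def Below (B B' : P.LocalBranching) : Prop :=
  ∃ (x' y' : P.Free) (c : x' ⟶ B.x) (d : B.y ⟶ y'), B' = B.whisker c d

/-- An overlapping branching that is minimal for the order `Below`. -/
def IsCritical (B : P.LocalBranching) : Prop :=
  B.IsOverlapping ∧ ∀ B' : P.LocalBranching, B'.Below B → B' = B

end LocalBranching

/-! ### Globular extensions of the free `(2,1)`-category -/

/-- A `2`-sphere: a pair of parallel `2`-cells of the free `(2,1)`-category. -/
structure TwoSphere (P : TwoPolygraph.{u, v, w}) where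
  {x : P.Free}
  {y : P.Free}
  {p : x ⟶ y}
  {q : x ⟶ y}
  fst : p ⟶ q
  snd : p ⟶ q

/-- A globular extension of the free `(2,1)`-category generated by `P`: a set of `3`-cells `A`, with
`boundary A` the `2`-sphere formed by the `2`-source and the `2`-target of `A`. -/
structure GlobularExtension (P : TwoPolygraph.{u, v, w}) where
  Cell : Type t
  boundary : Cell → P.TwoSphere

namespace GlobularExtension

/-- Formal composites of the `3`-cells of `E`. The `3`-cells of the free `(3,1)`-category generated
by `E` are the classes of these formal composites modulo the axioms of `(3,1)`-categories, so there
is a `3`-cell from `f` to `g` in that category if and only if `E.ThreeCell f g` is nonempty. -/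
inductive ThreeCell (E : GlobularExtension.{u, v, w, t} P) :
    ∀ {x y : P.Free} {p q : x ⟶ y}, (p ⟶ q) → (p ⟶ q) → Type (max u v w t)
  /-- a `3`-cell of the extension -/
  | of (A : E.Cell) : ThreeCell E (E.boundary A).fst (E.boundary A).snd
  /-- the identity of a `2`-cell -/
  | id {x y : P.Free} {p q : x ⟶ y} (f : p ⟶ q) : ThreeCell E f f
  /-- the inverse for the `2`-composition -/
  | inv {x y : P.Free} {p q : x ⟶ y} {f g : p ⟶ q} : ThreeCell E f g → ThreeCell E g f
  /-- the `2`-composition -/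
  | comp₂ {x y : P.Free} {p q : x ⟶ y} {f g h : p ⟶ q} :
      ThreeCell E f g → ThreeCell E g h → ThreeCell E f h
  /-- the `1`-composition -/
  | comp₁ {x y : P.Free} {p q r : x ⟶ y} {f f' : p ⟶ q} {g g' : q ⟶ r} :
      ThreeCell E f f' → ThreeCell E g g' → ThreeCell E (f ≫ g) (f' ≫ g')
  /-- the `0`-composition -/
  | comp₀ {x y z : P.Free} {p q : x ⟶ y} {r s : y ⟶ z} {f f' : p ⟶ q} {g g' : r ⟶ s} :
      ThreeCell E f f' → ThreeCell E g g' → ThreeCell E (f ▷ r ≫ q ◁ g) (f' ▷ r ≫ q ◁ g')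

/-- `E` is a homotopy basis: for every `2`-sphere `(f, g)` of the free `(2,1)`-category, there is a
`3`-cell from `f` to `g` in the free `(3,1)`-category. -/
def IsHomotopyBasis (E : GlobularExtension.{u, v, w, t} P) : Prop :=
  ∀ {x y : P.Free} {p q : x ⟶ y} (f g : p ⟶ q), Nonempty (E.ThreeCell f g)

/-- The `2`-sphere `S` is of the form `(f ⋆₁ f', g ⋆₁ g')`, where `B = (f, g)` and `(f', g')` is a
confluence completing `B`. -/
def IsConfluenceOf (S : P.TwoSphere) (B : P.LocalBranching) : Prop :=
  ∃ (r : B.x ⟶ B.y) (f' : RewritingSequence B.fst.tgt r) (g' : RewritingSequence B.snd.tgt r),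
    S = ⟨B.fst.toCell ≫ f'.toCell, eqToHom B.src_eq ≫ B.snd.toCell ≫ g'.toCell⟩

/-- `E` is a family of generating confluences: it is made of exactly one `3`-cell, filling a
confluence diagram, for each critical branching. Branchings are considered up to exchange of
their two members, as `(f, g)` and `(g, f)` have the same confluence diagrams up to orientation:
`branching A` is the critical branching, in the orientation given by the `3`-cell `A`. -/
def IsFamilyOfGeneratingConfluences (E : GlobularExtension.{u, v, w, t} P) : Prop :=
  ∃ branching : E.Cell → P.LocalBranching,
    (∀ A, (branching A).IsCritical ∧ IsConfluenceOf (E.boundary A) (branching A)) ∧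
    ∀ B : P.LocalBranching, B.IsCritical → ∃! A : E.Cell, branching A = B ∨ branching A = B.swap

end GlobularExtension

end TwoPolygraph

/-- A `(3,1)`-polygraph: a `2`-polygraph with a globular extension of its free `(2,1)`-category. -/
structure ThreeOnePolygraph where
  base : TwoPolygraph.{u, v, w}
  ext : TwoPolygraph.GlobularExtension.{u, v, w, t} base

namespace ThreeOnePolygraph

/-- `S` is an extended presentation of the category `C`. -/
def IsExtendedPresentation (S : ThreeOnePolygraph.{u, v, w, t}) (C : Type*) [Category* C] : Prop :=
  S.base.Presents C

/-- `S` is a coherent presentation of the category `C`. -/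
def IsCoherentPresentation (S : ThreeOnePolygraph.{u, v, w, t}) (C : Type*) [Category* C] : Prop :=
  S.IsExtendedPresentation C ∧ S.ext.IsHomotopyBasis

end ThreeOnePolygraph

/-- A Squier completion of a `2`-polygraph `P`: a `(3,1)`-polygraph that extends `P` by a chosen
family of generating confluences. -/
structure SquierCompletion (P : TwoPolygraph.{u, v, w}) where
  ext : TwoPolygraph.GlobularExtension.{u, v, w, t} P
  isFamily : ext.IsFamilyOfGeneratingConfluences

/-- The `(3,1)`-polygraph underlying a Squier completion. -/
def SquierCompletion.toThreeOnePolygraph {P : TwoPolygraph.{u, v, w}}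
    (S : SquierCompletion.{u, v, w, t} P) : ThreeOnePolygraph.{u, v, w, t} := ⟨P, S.ext⟩

/-!
If every critical branching is filled by a homotopy, then so is every local branching: one that is
neither aspherical nor Peiffer lies above a critical branching, whose filling is whiskered, the
aspherical ones are filled by an identity, and the Peiffer ones by the exchange law.

As in the proof of Newman's lemma, a noetherian induction on `p` then shows that a rewriting
sequence `p ⟹ n` into a normal form factors, up to homotopy, through any rewriting sequence
`p ⟹ q`. Taking `q = n`, any two rewriting sequences `p ⟹ n` are homotopic. Moreover, a `2`-cell
with a normal target that is homotopic to a rewriting sequence remains so when it is composed on the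
left with a rewriting step or, by the factorization, with the inverse of one; hence every `2`-cell
with a normal target is homotopic to a rewriting sequence. Two parallel `2`-cells thus become
homotopic once composed with a rewriting sequence from their target to a normal form, which can be
cancelled since all `2`-cells are invertible.
-/

namespace TwoPolygraph

section Strict

variable {B : Type*} [Bicategory B] [Strict B] {x' x y y' : B}

theorem id_whiskerLeft_whiskerRight_id {p q : x ⟶ y} (f : p ⟶ q) :
    𝟙 x ◁ f ▷ 𝟙 y =
      eqToHom (by rw [Strict.id_comp, Strict.comp_id]) ≫ f ≫
        eqToHom (by rw [Strict.id_comp, Strict.comp_id]) := by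
  simp [Strict.leftUnitor_eqToIso, Strict.rightUnitor_eqToIso]

theorem whiskerLeft_whiskerLeft_whiskerRight (c : x' ⟶ x) {z : B} (a : x ⟶ z) {p q : z ⟶ y}
    (f : p ⟶ q) (d : y ⟶ y') :
    c ◁ (a ◁ f) ▷ d =
      eqToHom (by simp only [Strict.assoc]) ≫ (c ≫ a) ◁ f ▷ d ≫
        eqToHom (by simp only [Strict.assoc]) := by
  simp [Strict.associator_eqToIso]

theorem whiskerLeft_whiskerRight_whiskerRight (c : x' ⟶ x) {z : B} {p q : x ⟶ z}
    (f : p ⟶ q) (a : z ⟶ y) (d : y ⟶ y') :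
    c ◁ (f ▷ a) ▷ d =
      eqToHom (by simp only [Strict.assoc]) ≫ c ◁ f ▷ (a ≫ d) ≫
        eqToHom (by simp only [Strict.assoc]) := by
  simp [Strict.associator_eqToIso]

theorem comp_whiskerLeft_whiskerRight_comp (c : x' ⟶ x) {z z' : B} (a : x ⟶ z) {p q : z ⟶ z'}
    (f : p ⟶ q) (b : z' ⟶ y) (d : y ⟶ y') :
    (c ≫ a) ◁ f ▷ (b ≫ d) =
      eqToHom (by simp only [Strict.assoc]) ≫ c ◁ (a ◁ f ▷ b) ▷ d ≫
        eqToHom (by simp only [Strict.assoc]) := by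
  simp [Strict.associator_eqToIso]

end Strict

variable {P : TwoPolygraph.{u, v, w}}

theorem TwoCell.inv_mk {x y : P.Free} {p q : x ⟶ y} (f : FormalCell P p q) :
    CategoryTheory.inv (X := p) (Y := q) (mk f) = mk f.inv :=
  IsIso.inv_eq_of_hom_inv_id ((homGroupoid x y).comp_inv (mk f))

theorem Free.hom_induction {x y : P.Free} {motive : ∀ {p q : x ⟶ y}, (p ⟶ q) → Prop}
    (id : ∀ p, motive (𝟙 p)) (step : ∀ f : P.Step x y, motive f.toCell)
    (comp : ∀ {p q r} {f : p ⟶ q} {g : q ⟶ r}, motive f → motive g → motive (f ≫ g))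
    (inv : ∀ {p q} {f : p ⟶ q}, motive f → motive (inv f)) {p q : x ⟶ y} (f : p ⟶ q) :
    motive f := by
  have eqToHom {p q : x ⟶ y} (h : p = q) : motive (eqToHom h) := by
    subst h
    exact id p
  have whisker_mk {x' y' : P.Free} {p q : x' ⟶ y'} (f : FormalCell P p q) (c : x ⟶ x')
      (d : y' ⟶ y) : motive (c ◁ (TwoCell.mk f : p ⟶ q) ▷ d) := by
    induction f with
    | of φ => exact step ⟨c, φ, d⟩
    | ofEq h =>
      rw [mk_ofEq, eqToHom_whiskerRight, Bicategory.whiskerLeft_eqToHom]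
      exact eqToHom _
    | comp f g hf hg =>
      have := comp (hf c d) (hg c d)
      rwa [← Bicategory.whiskerLeft_comp, ← comp_whiskerRight] at this
    | inv f hf =>
      have := inv (hf c d)
      rwa [inv_whiskerLeft, inv_whiskerRight, TwoCell.inv_mk] at this
    | whiskerL a f hf =>
      exact whiskerLeft_whiskerLeft_whiskerRight c a (TwoCell.mk f) d ▸
        comp (eqToHom _) (comp (hf (c ≫ a) d) (eqToHom _))
    | whiskerR f a hf =>
      exact whiskerLeft_whiskerRight_whiskerRight c (TwoCell.mk f) a d ▸
        comp (eqToHom _) (comp (hf c (a ≫ d)) (eqToHom _))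
  induction f using TwoCell.ind with | h f =>
  have := comp (eqToHom (by rw [Free.idComp, Free.compId]))
    (comp (whisker_mk f (𝟙 x) (𝟙 y)) (eqToHom (by rw [Free.idComp, Free.compId])))
  simpa only [id_whiskerLeft_whiskerRight_id, Category.assoc, eqToHom_trans_assoc, eqToHom_trans,
    eqToHom_refl, Category.id_comp, Category.comp_id] using this

/-! ### Positive two-cells -/

namespace Step

variable {x y x' y' : P.Free} (c : x' ⟶ x) (f : P.Step x y) (d : y ⟶ y')

theorem whisker_tgt : (f.whisker c d).tgt = c ≫ f.tgt ≫ d := by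
  simp only [tgt, whisker, Free.assoc]

theorem whisker_whisker {x'' y'' : P.Free} (c' : x'' ⟶ x') (d' : y' ⟶ y'') :
    (f.whisker c d).whisker c' d' = f.whisker (c' ≫ c) (d ≫ d') := by
  simp only [whisker, Free.assoc]

theorem whisker_id : f.whisker (𝟙 x) (𝟙 y) = f := by
  simp only [whisker, Free.idComp, Free.compId]

theorem toCell_whisker :
    (f.whisker c d).toCell =
      eqToHom (whisker_src c f d) ≫ c ◁ f.toCell ▷ d ≫ eqToHom (whisker_tgt c f d).symm :=
  comp_whiskerLeft_whiskerRight_comp c f.left (ofRule f.rule) f.right d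

end Step

/-- A `2`-cell of the free `(2,1)`-category is positive if it is the `1`-composite of a finite
rewriting sequence, that is, if it comes from the free `2`-category generated by `P`. -/
def IsPositive {x y : P.Free} {p q : x ⟶ y} (f : p ⟶ q) : Prop :=
  ∃ s : RewritingSequence p q, s.toCell = f

namespace IsPositive

variable {x y : P.Free} {p q r : x ⟶ y}

protected theorem eqToHom (h : p = q) : IsPositive (eqToHom h) := by
  subst h
  exact ⟨.nil p, rfl⟩

theorem step_comp (f : P.Step x y) {g : f.tgt ⟶ q} (hg : IsPositive g) :
    IsPositive (f.toCell ≫ g) := by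
  obtain ⟨s, rfl⟩ := hg
  exact ⟨.cons f rfl s, Category.id_comp _⟩

theorem step (f : P.Step x y) : IsPositive f.toCell := by
  simpa using step_comp f (.eqToHom rfl)

theorem comp {f : p ⟶ q} {g : q ⟶ r} (hf : IsPositive f) (hg : IsPositive g) :
    IsPositive (f ≫ g) := by
  obtain ⟨s, rfl⟩ := hf
  induction s with
  | nil p => simpa [RewritingSequence.toCell] using hg
  | cons f h s ih =>
    subst h
    simpa [RewritingSequence.toCell] using step_comp f (ih hg)

theorem whisker {x' y' : P.Free} (c : x' ⟶ x) {f : p ⟶ q} (hf : IsPositive f) (d : y ⟶ y') :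
    IsPositive (c ◁ f ▷ d) := by
  obtain ⟨s, rfl⟩ := hf
  induction s with
  | nil p => simpa [RewritingSequence.toCell] using IsPositive.eqToHom (rfl : c ≫ p ≫ d = _)
  | cons f h s ih =>
    subst h
    have := (IsPositive.eqToHom (Step.whisker_src c f d).symm).comp
      ((step (f.whisker c d)).comp ((IsPositive.eqToHom (Step.whisker_tgt c f d)).comp ih))
    simpa [RewritingSequence.toCell, Step.toCell_whisker] using this

end IsPositive

/-- A `1`-cell is normal if no rewriting step starts from it. -/
def IsNormal {x y : P.Free} (p : x ⟶ y) : Prop := ∀ f : P.Step x y, f.src ≠ p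

theorem IsNormal.eq_id_of_isPositive {x y : P.Free} {n : x ⟶ y} (hn : IsNormal n) {f : n ⟶ n}
    (hf : IsPositive f) : f = 𝟙 n := by
  obtain ⟨s, rfl⟩ := hf
  cases s with
  | nil => rfl
  | cons g h => exact absurd h (hn g)

theorem Terminating.wellFounded (hP : P.Terminating) (x y : P.Free) :
    WellFounded fun q p : x ⟶ y => ∃ f : P.Step x y, f.src = p ∧ f.tgt = q :=
  wellFounded_iff_isEmpty_descending_chain.mpr ⟨fun ⟨p, hp⟩ => hP x y ⟨p, hp⟩⟩

theorem Terminating.exists_isNormal (hP : P.Terminating) {x y : P.Free} (p : x ⟶ y) :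
    ∃ (n : x ⟶ y) (f : p ⟶ n), IsNormal n ∧ IsPositive f := by
  induction p using (hP.wellFounded x y).induction with | _ p ih =>
  by_cases hp : IsNormal p
  · exact ⟨p, 𝟙 p, hp, .eqToHom rfl⟩
  · obtain ⟨f, rfl⟩ : ∃ f : P.Step x y, f.src = p := by simpa [IsNormal] using hp
    obtain ⟨n, g, hn, hg⟩ := ih f.tgt ⟨f, rfl, rfl⟩
    exact ⟨n, f.toCell ≫ g, hn, hg.step_comp f⟩

/-! ### Local branchings -/

namespace LocalBranching

theorem whisker_id (B : P.LocalBranching) : B.whisker (𝟙 _) (𝟙 _) = B := by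
  simp only [whisker, Step.whisker_id]

theorem whisker_whisker (B : P.LocalBranching) {x' y' x'' y'' : P.Free} (c : x' ⟶ B.x)
    (d : B.y ⟶ y') (c' : x'' ⟶ x') (d' : y' ⟶ y'') :
    (B.whisker c d).whisker c' d' = B.whisker (c' ≫ c) (d ≫ d') := by
  simp only [whisker, Step.whisker_whisker]

theorem IsAspherical.whisker {B : P.LocalBranching} (hB : B.IsAspherical) {x' y' : P.Free}
    (c : x' ⟶ B.x) (d : B.y ⟶ y') : (B.whisker c d).IsAspherical :=
  congrArg (Step.whisker c · d) hB

theorem IsPeiffer.whisker {B : P.LocalBranching} (hB : B.IsPeiffer) {x' y' : P.Free}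
    (c : x' ⟶ B.x) (d : B.y ⟶ y') : (B.whisker c d).IsPeiffer := by
  obtain ⟨z, f, g, hfg⟩ := hB
  have whisker_f : (f.whisker (𝟙 B.x) g.src).whisker c d =
      (f.whisker c (𝟙 z)).whisker (𝟙 x') (g.whisker (𝟙 z) d).src := by
    simp only [Step.whisker_whisker, Step.whisker_src, Free.idComp, Free.compId]
  have whisker_g : (g.whisker f.src (𝟙 B.y)).whisker c d =
      (g.whisker (𝟙 z) d).whisker (f.whisker c (𝟙 z)).src (𝟙 y') := by
    simp only [Step.whisker_whisker, Step.whisker_src, Free.idComp, Free.compId]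
  refine ⟨z, f.whisker c (𝟙 z), g.whisker (𝟙 z) d, hfg.imp ?_ ?_⟩
  all_goals
    rintro ⟨hf, hg⟩
    exact ⟨(congrArg (Step.whisker c · d) hf).trans whisker_f,
      (congrArg (Step.whisker c · d) hg).trans whisker_g⟩

namespace Below

variable {B B' B'' : P.LocalBranching}

theorem refl (B : P.LocalBranching) : B.Below B :=
  ⟨_, _, 𝟙 _, 𝟙 _, B.whisker_id.symm⟩

theorem trans (h : B.Below B') (h' : B'.Below B'') : B.Below B'' := by
  obtain ⟨x', y', c, d, rfl⟩ := h
  obtain ⟨x'', y'', c', d', rfl⟩ := h'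
  exact ⟨_, _, _, _, whisker_whisker B c d c' d'⟩

theorem isOverlapping (h : B.Below B') (hB' : B'.IsOverlapping) : B.IsOverlapping := by
  obtain ⟨x', y', c, d, rfl⟩ := h
  exact ⟨fun hB => hB'.1 (hB.whisker c d), fun hB => hB'.2 (hB.whisker c d)⟩

end Below

/-- The number of generating `1`-cells in the common source of the two steps. -/
def length (B : P.LocalBranching) : ℕ := Quiver.Path.length (V := P.Obj) B.fst.src

theorem length_whisker (B : P.LocalBranching) {x' y' : P.Free} (c : x' ⟶ B.x) (d : B.y ⟶ y') :
    (B.whisker c d).length = Quiver.Path.length (V := P.Obj) c +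
      (B.length + Quiver.Path.length (V := P.Obj) d) := by
  rw [length, whisker, Step.whisker_src]
  exact (Quiver.Path.length_comp _ _).trans (congrArg _ (Quiver.Path.length_comp _ _))

theorem Below.eq_of_length_le {B B' : P.LocalBranching} (h : B.Below B')
    (hle : B'.length ≤ B.length) : B = B' := by
  obtain ⟨x', y', c, d, rfl⟩ := h
  rw [length_whisker] at hle
  have hc : Quiver.Path.length (V := P.Obj) c = 0 := by omega
  have hd : Quiver.Path.length (V := P.Obj) d = 0 := by omega
  obtain rfl := Quiver.Path.eq_of_length_zero c hc
  obtain rfl := Quiver.Path.eq_of_length_zero d hd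
  obtain rfl := Quiver.Path.eq_nil_of_length_zero c hc
  obtain rfl := Quiver.Path.eq_nil_of_length_zero d hd
  exact B.whisker_id.symm

theorem IsOverlapping.exists_isCritical_below {B : P.LocalBranching} (hB : B.IsOverlapping) :
    ∃ C : P.LocalBranching, C.IsCritical ∧ C.Below B := by
  obtain ⟨C, hCB, hmin⟩ := (measure length).wf.has_min {C | C.Below B} ⟨B, .refl B⟩
  exact ⟨C, ⟨hCB.isOverlapping hB,
    fun D hDC => hDC.eq_of_length_le (not_lt.mp (hmin D (hDC.trans hCB)))⟩, hCB⟩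

end LocalBranching

/-! ### Homotopies and fillings -/

namespace GlobularExtension

variable (E : GlobularExtension.{u, v, w, t} P)

/-- Two parallel `2`-cells are homotopic if there is a `3`-cell between them in the free
`(3,1)`-category generated by `E`. -/
def Homotopic {x y : P.Free} {p q : x ⟶ y} (f g : p ⟶ q) : Prop := Nonempty (E.ThreeCell f g)

variable {E}

namespace Homotopic

variable {x y : P.Free} {p q r : x ⟶ y}

theorem refl (f : p ⟶ q) : E.Homotopic f f := ⟨.id f⟩

theorem symm {f g : p ⟶ q} : E.Homotopic f g → E.Homotopic g f
  | ⟨A⟩ => ⟨.inv A⟩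

theorem trans {f g h : p ⟶ q} : E.Homotopic f g → E.Homotopic g h → E.Homotopic f h
  | ⟨A⟩, ⟨B⟩ => ⟨.comp₂ A B⟩

theorem comp_left (f : p ⟶ q) {g g' : q ⟶ r} : E.Homotopic g g' → E.Homotopic (f ≫ g) (f ≫ g')
  | ⟨A⟩ => ⟨.comp₁ (.id f) A⟩

theorem comp_right {f f' : p ⟶ q} (h : E.Homotopic f f') (g : q ⟶ r) :
    E.Homotopic (f ≫ g) (f' ≫ g) :=
  h.elim fun A => ⟨.comp₁ A (.id g)⟩

theorem of_comp_left {f : p ⟶ q} {g g' : q ⟶ r} (h : E.Homotopic (f ≫ g) (f ≫ g')) :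
    E.Homotopic g g' := by
  simpa using h.comp_left (inv f)

theorem of_comp_right {f f' : p ⟶ q} {g : q ⟶ r} (h : E.Homotopic (f ≫ g) (f' ≫ g)) :
    E.Homotopic f f' := by
  simpa using h.comp_right (inv g)

theorem whiskerRight {z : P.Free} {f g : p ⟶ q} (h : E.Homotopic f g) (d : y ⟶ z) :
    E.Homotopic (f ▷ d) (g ▷ d) := by
  obtain ⟨A⟩ := h
  simpa [Homotopic] using (⟨.comp₀ A (.id (𝟙 d))⟩ : E.Homotopic (f ▷ d ≫ q ◁ 𝟙 d) (g ▷ d ≫ q ◁ 𝟙 d))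

theorem whiskerLeft {z : P.Free} (c : z ⟶ x) {f g : p ⟶ q} (h : E.Homotopic f g) :
    E.Homotopic (c ◁ f) (c ◁ g) := by
  obtain ⟨A⟩ := h
  simpa [Homotopic] using (⟨.comp₀ (.id (𝟙 c)) A⟩ : E.Homotopic (𝟙 c ▷ p ≫ c ◁ f) (𝟙 c ▷ p ≫ c ◁ g))

end Homotopic

variable (E) in
/-- The rewriting steps `f` and `g` form a local branching that can be completed into a confluence
`(f ⋆₁ f', g ⋆₁ g')` whose two sides are homotopic. -/
def Fills {x y : P.Free} (f g : P.Step x y) : Prop :=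
  ∃ (h : f.src = g.src) (r : x ⟶ y) (f' : f.tgt ⟶ r) (g' : g.tgt ⟶ r),
    IsPositive f' ∧ IsPositive g' ∧ E.Homotopic (f.toCell ≫ f') (eqToHom h ≫ g.toCell ≫ g')

namespace Fills

variable {x y : P.Free}

theorem refl (f : P.Step x y) : E.Fills f f :=
  ⟨rfl, f.tgt, 𝟙 _, 𝟙 _, .eqToHom rfl, .eqToHom rfl, by simpa using .refl _⟩

theorem symm {f g : P.Step x y} : E.Fills f g → E.Fills g f := by
  rintro ⟨h, r, f', g', hf', hg', hfg⟩
  refine ⟨h.symm, r, g', f', hg', hf', ?_⟩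
  simpa using hfg.symm.comp_left (eqToHom h.symm)

theorem whisker {x' y' : P.Free} (c : x' ⟶ x) {f g : P.Step x y} (d : y ⟶ y') :
    E.Fills f g → E.Fills (f.whisker c d) (g.whisker c d) := by
  rintro ⟨h, r, f', g', hf', hg', hfg⟩
  refine ⟨by rw [Step.whisker_src, Step.whisker_src, h], c ≫ r ≫ d,
    eqToHom (Step.whisker_tgt c f d) ≫ c ◁ f' ▷ d, eqToHom (Step.whisker_tgt c g d) ≫ c ◁ g' ▷ d,
    (IsPositive.eqToHom _).comp (hf'.whisker c d),
    (IsPositive.eqToHom _).comp (hg'.whisker c d), ?_⟩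
  simpa [Step.toCell_whisker] using
    ((hfg.whiskerRight d).whiskerLeft c).comp_left (eqToHom (Step.whisker_src c f d))

theorem peiffer {z : P.Free} (f : P.Step x z) (g : P.Step z y) :
    E.Fills (f.whisker (𝟙 x) g.src) (g.whisker f.src (𝟙 y)) := by
  refine ⟨by simp only [Step.whisker_src, Free.idComp, Free.compId], f.tgt ≫ g.tgt,
    eqToHom (by simp only [Step.whisker_src, Step.whisker_tgt, Free.idComp, Free.compId]) ≫
      (g.whisker f.tgt (𝟙 y)).toCell ≫
        eqToHom (by simp only [Step.whisker_tgt, Free.compId]),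
    eqToHom (by simp only [Step.whisker_src, Step.whisker_tgt, Free.idComp, Free.compId]) ≫
      (f.whisker (𝟙 x) g.tgt).toCell ≫
        eqToHom (by simp only [Step.whisker_tgt, Free.idComp]),
    (IsPositive.eqToHom _).comp ((IsPositive.step _).comp (.eqToHom _)),
    (IsPositive.eqToHom _).comp ((IsPositive.step _).comp (.eqToHom _)), ?_⟩
  simpa [Step.toCell_whisker, Strict.leftUnitor_eqToIso, Strict.rightUnitor_eqToIso,
    whisker_exchange] using .refl _

end Fills

theorem fills_of_forall_isCritical_fills
    (hE : ∀ B : P.LocalBranching, B.IsCritical → E.Fills B.fst B.snd) (B : P.LocalBranching) :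
    E.Fills B.fst B.snd := by
  by_cases hB : B.IsOverlapping
  · obtain ⟨C, hC, x', y', c, d, rfl⟩ := hB.exists_isCritical_below
    exact (hE C hC).whisker c d
  · rcases not_and_or.mp hB with hB | hB
    · obtain hfg : B.fst = B.snd := not_not.mp hB
      exact hfg ▸ .refl B.fst
    · obtain ⟨z, f, g, ⟨hf, hg⟩ | ⟨hg, hf⟩⟩ := not_not.mp hB
      · exact hf ▸ hg ▸ .peiffer f g
      · exact hf ▸ hg ▸ (Fills.peiffer f g).symm

theorem IsFamilyOfGeneratingConfluences.fills (hE : E.IsFamilyOfGeneratingConfluences)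
    {B : P.LocalBranching} (hB : B.IsCritical) : E.Fills B.fst B.snd := by
  obtain ⟨branching, hbranching, hcritical⟩ := hE
  have fills_branching (A : E.Cell) : E.Fills (branching A).fst (branching A).snd := by
    obtain ⟨r, f', g', hA⟩ := (hbranching A).2
    have h : E.Homotopic (E.boundary A).fst (E.boundary A).snd := ⟨.of A⟩
    rw [hA] at h
    exact ⟨(branching A).src_eq, r, _, _, ⟨f', rfl⟩, ⟨g', rfl⟩, h⟩
  obtain ⟨A, rfl | hA, -⟩ := hcritical B hB
  · exact fills_branching A
  · exact (show E.Fills B.swap.fst B.swap.snd from hA ▸ fills_branching A).symm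

/-! ### Squier's theorem -/

section Squier

variable (hP : P.Terminating) (hE : ∀ B : P.LocalBranching, E.Fills B.fst B.snd) {x y : P.Free}
  {p q n : x ⟶ y}

include hP hE

theorem exists_homotopic_comp (hn : IsNormal n) {s : p ⟶ n} (hs : IsPositive s) {t : p ⟶ q}
    (ht : IsPositive t) : ∃ u : q ⟶ n, IsPositive u ∧ E.Homotopic s (t ≫ u) := by
  induction p using (hP.wellFounded x y).induction generalizing q with | _ p ih =>
  obtain ⟨_ | ⟨g, hg, t⟩, rfl⟩ := ht
  · exact ⟨s, hs, by simpa [RewritingSequence.toCell] using .refl s⟩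
  obtain ⟨_ | ⟨f, rfl, s⟩, rfl⟩ := hs
  · exact absurd hg (hn g)
  obtain ⟨_, r, f', g', hf', hg', hfg⟩ := hE ⟨f, g, hg.symm⟩
  obtain ⟨k, hk, hsk⟩ := ih _ ⟨f, rfl, rfl⟩ ⟨s, rfl⟩ hf'
  obtain ⟨u, hu, hku⟩ := ih _ ⟨g, hg, rfl⟩ (hg'.comp hk) ⟨t, rfl⟩
  have hleft : E.Homotopic (f.toCell ≫ s.toCell) (f.toCell ≫ f' ≫ k) := hsk.comp_left _
  have hmid : E.Homotopic (f.toCell ≫ f' ≫ k) (eqToHom hg.symm ≫ g.toCell ≫ g' ≫ k) := by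
    simpa using hfg.comp_right k
  have hright : E.Homotopic (eqToHom hg.symm ≫ g.toCell ≫ g' ≫ k)
      (eqToHom hg.symm ≫ g.toCell ≫ t.toCell ≫ u) := by
    simpa using (hku.comp_left g.toCell).comp_left (eqToHom hg.symm)
  refine ⟨u, hu, ?_⟩
  simpa [RewritingSequence.toCell] using (hleft.trans hmid).trans hright

theorem homotopic_of_isPositive (hn : IsNormal n) {s t : p ⟶ n} (hs : IsPositive s)
    (ht : IsPositive t) : E.Homotopic s t := by
  obtain ⟨u, hu, h⟩ := exists_homotopic_comp hP hE hn hs ht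
  rwa [hn.eq_id_of_isPositive hu, Category.comp_id] at h

theorem exists_isPositive_homotopic_comp_iff (hn : IsNormal n) (f : p ⟶ q) (g : q ⟶ n) :
    (∃ s, IsPositive s ∧ E.Homotopic s (f ≫ g)) ↔ ∃ s, IsPositive s ∧ E.Homotopic s g := by
  induction f using Free.hom_induction with
  | id p => rw [Category.id_comp]
  | step f =>
    constructor
    · rintro ⟨s, hs, h⟩
      obtain ⟨u, hu, hsu⟩ := exists_homotopic_comp hP hE hn hs (.step f)
      exact ⟨u, hu, .of_comp_left (hsu.symm.trans h)⟩
    · rintro ⟨s, hs, h⟩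
      exact ⟨f.toCell ≫ s, hs.step_comp f, h.comp_left f.toCell⟩
  | comp hf hf' => rw [Category.assoc, hf, hf']
  | inv hf => rw [← hf, IsIso.hom_inv_id_assoc]

theorem exists_isPositive_homotopic (hn : IsNormal n) (f : p ⟶ n) :
    ∃ s, IsPositive s ∧ E.Homotopic s f := by
  simpa using (exists_isPositive_homotopic_comp_iff hP hE hn f (𝟙 n)).mpr
    ⟨𝟙 n, .eqToHom rfl, .refl _⟩

theorem isHomotopyBasis_of_fills : E.IsHomotopyBasis := by
  intro x y p q f g
  obtain ⟨n, h, hn, -⟩ := hP.exists_isNormal q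
  obtain ⟨s, hs, hsf⟩ := exists_isPositive_homotopic hP hE hn (f ≫ h)
  obtain ⟨t, ht, htg⟩ := exists_isPositive_homotopic hP hE hn (g ≫ h)
  have hst : E.Homotopic s t := homotopic_of_isPositive hP hE hn hs ht
  exact ((hsf.symm.trans hst).trans htg).of_comp_right

end Squier

end GlobularExtension

theorem presents_presentedCategory (P : TwoPolygraph.{u, v, w}) :
    P.Presents P.PresentedCategory := ⟨𝟭 _, 𝟭 _, rfl, rfl⟩

end TwoPolygraph

theorem mainTheorem3_general (P : TwoPolygraph.{u, v, w}) (hP : P.Terminating)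
    (E : TwoPolygraph.GlobularExtension.{u, v, w, t} P)
    (hE : ∀ B : P.LocalBranching, B.IsCritical → E.Fills B.fst B.snd) :
    (⟨P, E⟩ : ThreeOnePolygraph).IsCoherentPresentation P.PresentedCategory :=
  ⟨P.presents_presentedCategory,
    TwoPolygraph.GlobularExtension.isHomotopyBasis_of_fills hP <|
      TwoPolygraph.GlobularExtension.fills_of_forall_isCritical_fills hE⟩

theorem mainTheorem3 (P : TwoPolygraph.{u, v, w}) (hP : P.Convergent)
    (S : SquierCompletion.{u, v, w, t} P) :
    S.toThreeOnePolygraph.IsCoherentPresentation P.PresentedCategory :=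
  mainTheorem3_general P hP.2 S.ext fun _ => S.isFamily.fills
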